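/- Let $d,l>0$ and let $(M^{d+l},g)$ be a CR-submanifold of $\mathbb{C}^q$: a smooth manifold with a smooth isometric immersion into $\mathbb{C}^q$ (standard Hermitian structure, $J$ = multiplication by $i$) such that the subspaces $D_x=J(T_xM)\cap T_xM$, $x\in M$, all have real dimension $d$. Let $R$ be the curvature tensor of the Levi-Civita connection of $g$, with the sign $R_{X,Y}=\nabla_X\nabla_Y-\nabla_Y\nabla_X-\nabla_{[X,Y]}$, and let $h$ be the second fundamental form of $M$ in $\mathbb{C}^q$. Define the following at $x\in M$. * For a subspace $V\subset T_xM$ with orthonormal basis $(e_i)$, let $H_V=\sum_i h(e_i,e_i)$; put $H_D=H_{D_x}$. For $1\le s\le d$ let $\mathcal{H}_D(s)=\max\{\|H_V\| : V\subset D_x,\ \dim V=s\}$. * For subspaces $V_1,\dots,V_k$ of $T_xM$ let $S_{\rm m}(V_1,\dots,V_k)=\sum_{i<j}\sum_{a,b} g(R_{e_a,e_b}e_b,e_a)$, where in the $(i,j)$ term $(e_a)$ and $(e_b)$ are orthonormal bases of $V_i$ and $V_j$. * For $k\ge2$ and integers $n_1,\dots,n_k\ge1$ with $\sum_i n_i\le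 d$, let $\delta^+_{{\rm m},D}(n_1,\dots,n_k)=\max S_{\rm m}(V_1,\dots,V_k)$ over all mutually orthogonal subspaces $V_1,\dots,V_k$ of $D_x$ with $\dim V_i=n_i$, and let $\Delta_{{\rm m},D}(n_1,\dots,n_k)=\frac{2k}{k-1}\,\delta^+_{{\rm m},D}(n_1,\dots,n_k)$. * For $2\le s\le d$ let $\bar\Delta_{{\rm m},D}(s)$ be the maximum of $\Delta_{{\rm m},D}(n_1,\dots,n_k)$ over all $k\ge2$ and all integers $n_1,\dots,n_k\ge1$ with $\sum_i n_i=s$. Then, at every point $x\in M$, all these maxima are attained, and $$\mathcal{H}_D(s)^2\ \ge\ \bar\Delta_{{\rm m},D}(s)\quad\text{for every } 2\le s<d,\qquad\text{and}\qquad \|H_D\|^2\ \ge\ \bar\Delta_{{\rm m},D}(d).$$ -/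

import Mathlib

open Bundle Manifold Module
open scoped ContDiff

noncomputable section

namespace CRGeom

/-! ### Riemannian manifolds: curvature in charts

`M` is a smooth `n`-manifold, and `g` is the inner product on the tangent spaces supplied by
`RiemannianBundle`. -/

section Riemannian

variable {n : ℕ} {M : Type*} [TopologicalSpace M] [ChartedSpace (EuclideanSpace ℝ (Fin n)) M]

instance instFiniteDimensionalTangentSpace (x : M) : FiniteDimensional ℝ (TangentSpace (𝓡 n) x) :=
  inferInstanceAs (FiniteDimensional ℝ (EuclideanSpace ℝ (Fin n)))

/-- Partial derivative `∂ᵢ φ` of a real function of `n` coordinates. -/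
def pderiv (i : Fin n) (φ : EuclideanSpace ℝ (Fin n) → ℝ) (u : EuclideanSpace ℝ (Fin n)) : ℝ :=
  fderiv ℝ φ u (EuclideanSpace.single i 1)

variable [IsManifold (𝓡 n) ∞ M]

/-- The coordinate vector `∂ᵢ` of the chart at `x`, at the point with coordinates `u`. -/
def coordVec (x : M) (i : Fin n) (u : EuclideanSpace ℝ (Fin n)) :
    TangentSpace (𝓡 n) ((extChartAt (𝓡 n) x).symm u) :=
  mfderiv 𝓘(ℝ, EuclideanSpace ℝ (Fin n)) (𝓡 n) (extChartAt (𝓡 n) x).symm u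
    (EuclideanSpace.single i (1 : ℝ) : EuclideanSpace ℝ (Fin n))

/-- The coordinates `(v¹, …, vⁿ)` of a tangent vector `v ∈ T_x M` in the chart at `x`. -/
def coords (x : M) (v : TangentSpace (𝓡 n) x) : EuclideanSpace ℝ (Fin n) :=
  mfderiv (𝓡 n) 𝓘(ℝ, EuclideanSpace ℝ (Fin n)) (extChartAt (𝓡 n) x) x v

variable [RiemannianBundle (fun x : M => TangentSpace (𝓡 n) x)]

/-- The matrix `gᵢⱼ = g(∂ᵢ, ∂ⱼ)` of the metric in the chart at `x`. -/
def metricMatrix (x : M) (u : EuclideanSpace ℝ (Fin n)) : Matrix (Fin n) (Fin n) ℝ :=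
  Matrix.of fun i j => inner ℝ (coordVec x i u) (coordVec x j u)

/-- Christoffel symbols of the Levi-Civita connection, `∇_{∂ᵢ} ∂ⱼ = ∑ₖ Γᵏᵢⱼ ∂ₖ`:
`Γᵏᵢⱼ = ½ ∑ₗ gᵏˡ (∂ᵢ gⱼₗ + ∂ⱼ gᵢₗ - ∂ₗ gᵢⱼ)`. -/
def christoffel (x : M) (k i j : Fin n) (u : EuclideanSpace ℝ (Fin n)) : ℝ :=
  (1 / 2) * ∑ l, (metricMatrix x u)⁻¹ k l *
    (pderiv i (fun w => metricMatrix x w j l) u + pderiv j (fun w => metricMatrix x w i l) u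
      - pderiv l (fun w => metricMatrix x w i j) u)

/-- Components of the curvature tensor `R_{X,Y} = ∇_X ∇_Y - ∇_Y ∇_X - ∇_{[X,Y]}`:
`curvatureCoeff x l i j k` is the `l`-th component of `R_{∂ᵢ,∂ⱼ} ∂ₖ`. -/
def curvatureCoeff (x : M) (l i j k : Fin n) (u : EuclideanSpace ℝ (Fin n)) : ℝ :=
  pderiv i (christoffel x l j k) u - pderiv j (christoffel x l i k) u
    + ∑ m, (christoffel x m j k u * christoffel x l i m u
      - christoffel x m i k u * christoffel x l j m u)

/-- The Riemann curvature tensor `g(R_{X,Y} Z, W)` at `x`. -/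
def riemann (x : M) (X Y Z W : TangentSpace (𝓡 n) x) : ℝ :=
  ∑ i, ∑ j, ∑ k, ∑ l, ∑ m,
    coords x X i * coords x Y j * coords x Z k * coords x W m
      * curvatureCoeff x l i j k (extChartAt (𝓡 n) x x)
      * metricMatrix x (extChartAt (𝓡 n) x x) l m

/-- The mutual curvature `S_m(V, W) = ∑_{a,b} g(R_{e_a,e_b} e_b, e_a)` of two subspaces, with `e_a`
and `e_b` running over orthonormal bases of `V` and of `W`. -/
def mutualCurvature₂ (x : M) (V W : Submodule ℝ (TangentSpace (𝓡 n) x)) : ℝ :=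
  ∑ a, ∑ b, riemann x (stdOrthonormalBasis ℝ V a : TangentSpace (𝓡 n) x)
    (stdOrthonormalBasis ℝ W b : TangentSpace (𝓡 n) x)
    (stdOrthonormalBasis ℝ W b : TangentSpace (𝓡 n) x)
    (stdOrthonormalBasis ℝ V a : TangentSpace (𝓡 n) x)

/-- The mutual curvature `S_m(V₁, …, V_k) = ∑_{i<j} S_m(V_i, V_j)` of a set of subspaces. -/
def mutualCurvature (x : M) {k : ℕ} (V : Fin k → Submodule ℝ (TangentSpace (𝓡 n) x)) : ℝ :=
  ∑ i, ∑ j ∈ Finset.Ioi i, mutualCurvature₂ x (V i) (V j)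

/-- The values `S_m(V₁, …, V_k)` over all mutually orthogonal subspaces `V₁, …, V_k` of `D_x` with
`dim V_i = n_i`. -/
def mutualCurvatureValues (D : ∀ x : M, Submodule ℝ (TangentSpace (𝓡 n) x)) {k : ℕ}
    (ν : Fin k → ℕ) (x : M) : Set ℝ :=
  {r | ∃ V : Fin k → Submodule ℝ (TangentSpace (𝓡 n) x),
    (∀ i, V i ≤ D x) ∧ (∀ i j, i ≠ j → V i ⟂ V j) ∧ (∀ i, finrank ℝ (V i) = ν i) ∧
    r = mutualCurvature x V}

/-- The mutual curvature invariant `δ⁺_{m,D}(n₁, …, n_k)(x) = max S_m(V₁, …, V_k)`. -/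
def deltaPlus (D : ∀ x : M, Submodule ℝ (TangentSpace (𝓡 n) x)) {k : ℕ}
    (ν : Fin k → ℕ) (x : M) : ℝ :=
  sSup (mutualCurvatureValues D ν x)

/-- The normalized curvature `Δ_{m,D}(n₁, …, n_k) = (2k / (k - 1)) δ⁺_{m,D}(n₁, …, n_k)`. -/
def normalizedDelta (D : ∀ x : M, Submodule ℝ (TangentSpace (𝓡 n) x)) {k : ℕ}
    (ν : Fin k → ℕ) (x : M) : ℝ :=
  (2 * (k : ℝ) / ((k : ℝ) - 1)) * deltaPlus D ν x

/-- The values `Δ_{m,D}(n₁, …, n_k)(x)` over all `k ≥ 2` and all positive integers `n₁, …, n_k`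
with `n₁ + ⋯ + n_k = s`. -/
def normalizedDeltaValues (D : ∀ x : M, Submodule ℝ (TangentSpace (𝓡 n) x)) (s : ℕ) (x : M) :
    Set ℝ :=
  {r | ∃ (k : ℕ) (ν : Fin k → ℕ), 2 ≤ k ∧ (∀ i, 1 ≤ ν i) ∧ ∑ i, ν i = s ∧
    r = normalizedDelta D ν x}

/-- `Δ̄_{m,D}(s)(x)`, the maximum of `Δ_{m,D}(n₁, …, n_k)(x)` over `n₁ + ⋯ + n_k = s`. -/
def maxNormalizedDelta (D : ∀ x : M, Submodule ℝ (TangentSpace (𝓡 n) x)) (s : ℕ) (x : M) : ℝ :=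
  sSup (normalizedDeltaValues D s x)

end Riemannian

/-! ### Submanifolds of `ℂ^q` -/

section Submanifold

variable (n : ℕ) {q : ℕ} {M : Type*} [TopologicalSpace M] [ChartedSpace (EuclideanSpace ℝ (Fin n)) M]
  [IsManifold (𝓡 n) ∞ M]

/-- The differential `df_x : T_x M → ℂ^q`, an `ℝ`-linear map. -/
def differential (f : M → EuclideanSpace ℂ (Fin q)) (x : M) :
    TangentSpace (𝓡 n) x →L[ℝ] EuclideanSpace ℂ (Fin q) :=
  mfderiv (𝓡 n) 𝓘(ℝ, EuclideanSpace ℂ (Fin q)) f x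

/-- The tangent space of the submanifold, as a real subspace of `ℂ^q`. -/
def tangentImage (f : M → EuclideanSpace ℂ (Fin q)) (x : M) :
    Submodule ℝ (EuclideanSpace ℂ (Fin q)) :=
  LinearMap.range (differential n f x).toLinearMap

/-- The complex structure `J` of `ℂ^q`: multiplication by `i`, as an `ℝ`-linear map. -/
def complexStructure (q : ℕ) : EuclideanSpace ℂ (Fin q) →ₗ[ℝ] EuclideanSpace ℂ (Fin q) where
  toFun v := Complex.I • v
  map_add' v w := smul_add _ v w
  map_smul' r v := smul_comm _ r v

/-- The maximal complex distribution `D = J(TM) ∩ TM`, as subspaces of the tangent spaces `T_x M`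
(which `df_x` identifies with their images in `ℂ^q`). -/
def complexDistribution (f : M → EuclideanSpace ℂ (Fin q)) (x : M) :
    Submodule ℝ (TangentSpace (𝓡 n) x) :=
  ((tangentImage n f x).map (complexStructure q) ⊓ tangentImage n f x).comap
    (differential n f x).toLinearMap

/-- The second fundamental form `h(v, w)` at `x`: the component normal to `M` of the derivative in
the direction `v` of the tangent field `df(Y)`, where `Y` is the vector field with constant
coordinates in the chart at `x` such that `Y x = w`. -/
def secondFundamentalForm (f : M → EuclideanSpace ℂ (Fin q)) (x : M)
    (v w : TangentSpace (𝓡 n) x) : EuclideanSpace ℂ (Fin q) :=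
  (tangentImage n f x)ᗮ.starProjection
    (fderiv ℝ (fun u => fderiv ℝ (f ∘ (extChartAt (𝓡 n) x).symm) u (coords x w))
      (extChartAt (𝓡 n) x x) (coords x v))

variable [RiemannianBundle (fun x : M => TangentSpace (𝓡 n) x)]

/-- The mean curvature vector `H_V = ∑ᵢ h(eᵢ, eᵢ)` of a subspace `V ⊂ T_x M`, with `eᵢ` running
over an orthonormal basis of `V`. -/
def meanCurvature (f : M → EuclideanSpace ℂ (Fin q)) (x : M)
    (V : Submodule ℝ (TangentSpace (𝓡 n) x)) : EuclideanSpace ℂ (Fin q) :=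
  ∑ i, secondFundamentalForm n f x (stdOrthonormalBasis ℝ V i : TangentSpace (𝓡 n) x)
    (stdOrthonormalBasis ℝ V i : TangentSpace (𝓡 n) x)

/-- The values `‖H_V‖` over all subspaces `V ⊂ D_x` of dimension `s`. -/
def meanCurvatureValues (f : M → EuclideanSpace ℂ (Fin q)) (s : ℕ) (x : M) : Set ℝ :=
  {r | ∃ V : Submodule ℝ (TangentSpace (𝓡 n) x),
    V ≤ complexDistribution n f x ∧ finrank ℝ V = s ∧ r = ‖meanCurvature n f x V‖}

/-- The intermediate mean curvature `𝓗_D(s)(x) = max {‖H_V‖ : V ⊂ D_x, dim V = s}`. -/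
def maxMeanCurvature (f : M → EuclideanSpace ℂ (Fin q)) (s : ℕ) (x : M) : ℝ :=
  sSup (meanCurvatureValues n f s x)

end Submanifold

/-- `f : M → ℂ^q` makes the Riemannian manifold `M` of dimension `d + l` (`d, l > 0`) a (smooth,
isometrically immersed) CR-submanifold of `ℂ^q`: the distribution `D = J(TM) ∩ TM` has constant
real dimension `d`. -/
structure IsCRSubmanifold {d l q : ℕ} {M : Type*} [TopologicalSpace M]
    [ChartedSpace (EuclideanSpace ℝ (Fin (d + l))) M] [IsManifold (𝓡 (d + l)) ∞ M]
    [RiemannianBundle (fun x : M => TangentSpace (𝓡 (d + l)) x)]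
    (f : M → EuclideanSpace ℂ (Fin q)) : Prop where
  d_pos : 0 < d
  l_pos : 0 < l
  smooth : ContMDiff (𝓡 (d + l)) 𝓘(ℝ, EuclideanSpace ℂ (Fin q)) ∞ f
  isometric : ∀ (x : M) (v w : TangentSpace (𝓡 (d + l)) x),
    inner ℝ (differential (d + l) f x v) (differential (d + l) f x w) = inner ℝ v w
  finrank_eq : ∀ x : M, finrank ℝ (complexDistribution (d + l) f x) = d

end CRGeom

end

/-! Since `ℂ^q` is flat, the Gauss equation gives `g(R_{v,w} w, v) = ⟨h(v,v), h(w,w)⟩ - ‖h(v,w)‖²`.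
Summing over orthonormal bases of mutually orthogonal `V₁, …, V_k` and dropping the squares bounds
the mutual curvature by `∑_{i<j} ⟨H_{V_i}, H_{V_j}⟩`. By Cauchy–Schwarz this is at most `(k-1)/(2k)
‖∑ H_{V_i}‖²`, and `∑ H_{V_i} = H_V` for `V = ⊕ V_i`. The factor `2k/(k-1)` in the definition of `Δ`
is the inverse of this constant. Taking the `V_i` that realise the maximal `Δ` gives a `V ⊂ D` of
dimension `s` with `Δ̄(s) ≤ ‖H_V‖²`; if `s = d`, then `V = D`.

The algebraic inequality is `sum_gaussTerm_le` and the Gauss equation is `gauss_equation`, carried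
to `M` by `riemann_eq`. The maxima over subspaces exist because both quantities are continuous
functions of an orthonormal frame in `D`, and such frames form a compact set. Beyond the dimension
of `D`, the complex structure plays no role. -/

namespace CRGeom

/-! ### The algebraic inequality for a symmetric bilinear map. -/

section GaussTerm

variable {E : Type*} [AddCommGroup E] [Module ℝ E]
  {N : Type*} [NormedAddCommGroup N] [InnerProductSpace ℝ N]

/-- The right hand side of the Gauss equation for the sectional part of the curvature:
`⟨B(v,v), B(w,w)⟩ - ‖B(v,w)‖²`. -/
noncomputable def gaussTerm (B : E →ₗ[ℝ] E →ₗ[ℝ] N) (v w : E) : ℝ :=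
  inner ℝ (B w w) (B v v) - inner ℝ (B v w) (B w v)

/-- `gaussTerm` as the diagonal of a bilinear form in the first vector. -/
noncomputable def gaussForm (B : E →ₗ[ℝ] E →ₗ[ℝ] N) (w : E) : E →ₗ[ℝ] E →ₗ[ℝ] ℝ :=
  LinearMap.mk₂ ℝ (fun v v' => inner ℝ (B w w) (B v v') - inner ℝ (B v w) (B w v'))
    (fun _ _ _ => by simp [inner_add_left, inner_add_right]; ring)
    (fun _ _ _ => by simp [inner_smul_left, inner_smul_right]; ring)
    (fun _ _ _ => by simp [inner_add_right]; ring)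
    (fun _ _ _ => by simp [inner_smul_right]; ring)

/-- `gaussTerm` as the diagonal of a bilinear form in the second vector. -/
noncomputable def gaussForm' (B : E →ₗ[ℝ] E →ₗ[ℝ] N) (v : E) : E →ₗ[ℝ] E →ₗ[ℝ] ℝ :=
  LinearMap.mk₂ ℝ (fun w w' => inner ℝ (B w w') (B v v) - inner ℝ (B v w) (B w' v))
    (fun _ _ _ => by simp [inner_add_left]; ring)
    (fun _ _ _ => by simp [inner_smul_left]; ring)
    (fun _ _ _ => by simp [inner_add_left, inner_add_right]; ring)
    (fun _ _ _ => by simp [inner_smul_left, inner_smul_right]; ring)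

/-- `2 ∑_{i<j} ⟨Hᵢ, Hⱼ⟩ ≤ (1 - 1/k) ‖∑ᵢ Hᵢ‖²`. -/
theorem sum_inner_lt_le {k : ℕ} (hk : 2 ≤ k) (H : Fin k → N) :
    (2 * (k : ℝ) / ((k : ℝ) - 1)) * ∑ i, ∑ j ∈ Finset.Ioi i, inner ℝ (H i) (H j)
      ≤ ‖∑ i, H i‖ ^ 2 := by
  have hk' : (2 : ℝ) ≤ k := by exact_mod_cast hk
  have hexp : ‖∑ i, H i‖ ^ 2 = ∑ i, ‖H i‖ ^ 2
      + 2 * ∑ i, ∑ j ∈ Finset.Ioi i, inner ℝ (H i) (H j) := by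
    have h1 : ∀ i, ∑ j, inner ℝ (H i) (H j) = ‖H i‖ ^ 2 +
        (∑ j ∈ Finset.Ioi i, inner ℝ (H i) (H j) + ∑ j ∈ Finset.Iio i, inner ℝ (H i) (H j)) := by
      intro i
      rw [← real_inner_self_eq_norm_sq, ← Finset.sum_filter_add_sum_filter_not Finset.univ
        (fun j => j = i), ← Finset.sum_filter_add_sum_filter_not
        (Finset.univ.filter fun j => ¬ j = i) (fun j => i < j)]
      congr 1
      · simp [Finset.filter_eq']
      · congr 1
        · refine Finset.sum_congr ?_ fun _ _ => rfl
          ext j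
          simp only [Finset.mem_filter, Finset.mem_univ, true_and, Finset.mem_Ioi]
          grind
        · refine Finset.sum_congr ?_ fun _ _ => rfl
          ext j
          simp only [Finset.mem_filter, Finset.mem_univ, true_and, Finset.mem_Iio]
          grind
    have h2 : ∑ i, ∑ j ∈ Finset.Iio i, inner ℝ (H i) (H j)
        = ∑ i, ∑ j ∈ Finset.Ioi i, inner ℝ (H i) (H j) := by
      rw [Finset.sum_comm' (t' := Finset.univ) (s' := fun j => Finset.Ioi j) (by simp)]
      exact Finset.sum_congr rfl fun i _ => Finset.sum_congr rfl fun j _ => real_inner_comm _ _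
    rw [← real_inner_self_eq_norm_sq, sum_inner]
    simp_rw [inner_sum, h1, Finset.sum_add_distrib, h2]
    ring
  -- Triangle inequality, then Cauchy–Schwarz. With `hexp` this eliminates `∑ ‖Hᵢ‖²`, which is where
  -- `1 - 1/k` comes from.
  have hcs : ‖∑ i, H i‖ ^ 2 ≤ k * ∑ i, ‖H i‖ ^ 2 := by
    have h1 := sq_sum_le_card_mul_sum_sq (s := (Finset.univ : Finset (Fin k)))
      (f := fun i => ‖H i‖)
    rw [Finset.card_univ, Fintype.card_fin] at h1
    exact (pow_le_pow_left₀ (norm_nonneg _) (norm_sum_le _ _) 2).trans h1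
  rw [div_mul_eq_mul_div, div_le_iff₀ (by linarith)]
  nlinarith

/-- The algebraic form of the main inequality. -/
theorem sum_gaussTerm_le (B : E →ₗ[ℝ] E →ₗ[ℝ] N) (hB : ∀ v w, B v w = B w v) {k : ℕ}
    (hk : 2 ≤ k) {ν : Fin k → ℕ} (v : ∀ i, Fin (ν i) → E) :
    (2 * (k : ℝ) / ((k : ℝ) - 1)) *
        ∑ i, ∑ j ∈ Finset.Ioi i, ∑ a, ∑ b, gaussTerm B (v i a) (v j b)
      ≤ ‖∑ p : Σ i, Fin (ν i), B (v p.1 p.2) (v p.1 p.2)‖ ^ 2 := by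
  have hk' : (2 : ℝ) ≤ k := by exact_mod_cast hk
  rw [Fintype.sum_sigma]
  refine le_trans (mul_le_mul_of_nonneg_left ?_ (by apply div_nonneg <;> linarith))
    (sum_inner_lt_le hk fun i => ∑ a, B (v i a) (v i a))
  refine Finset.sum_le_sum fun i _ => Finset.sum_le_sum fun j _ => ?_
  rw [sum_inner]
  refine Finset.sum_le_sum fun a _ => ?_
  rw [inner_sum]
  refine Finset.sum_le_sum fun b _ => ?_
  -- Symmetry turns the subtracted term into a square, which is then discarded.
  rw [gaussTerm, hB (v j b) (v i a), real_inner_comm]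
  linarith [real_inner_self_nonneg (x := B (v i a) (v j b))]

end GaussTerm

/-! ### Independence of orthonormal bases, and compactness of frames. -/

section LinearAlgebra

variable {E : Type*} [NormedAddCommGroup E] [InnerProductSpace ℝ E]

/-- The diagonal sum of a bilinear map does not depend on the orthonormal basis. -/
theorem sum_bilin_orthonormalBasis_eq {N : Type*} [AddCommGroup N] [Module ℝ N]
    {ι κ : Type*} [Fintype ι] [Fintype κ] (b : OrthonormalBasis ι ℝ E)
    (c : OrthonormalBasis κ ℝ E) (B : E →ₗ[ℝ] E →ₗ[ℝ] N) :
    ∑ i, B (b i) (b i) = ∑ j, B (c j) (c j) := by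
  have h1 : ∀ i, B (b i) (b i) = ∑ j, ∑ k, (inner ℝ (c j) (b i) * inner ℝ (b i) (c k)) •
      B (c j) (c k) := by
    intro i
    conv_lhs => rw [← c.sum_repr' (b i)]
    simp only [map_sum, LinearMap.sum_apply, map_smul, LinearMap.smul_apply, Finset.smul_sum,
      smul_smul]
    rw [Finset.sum_comm]
    refine Finset.sum_congr rfl fun j _ => Finset.sum_congr rfl fun k _ => ?_
    rw [real_inner_comm (b i) (c k), mul_comm]

  simp_rw [h1]
  rw [Finset.sum_comm]
  refine Finset.sum_congr rfl fun j _ => ?_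
  rw [Finset.sum_comm]
  -- Parseval for `b` collapses the coefficient of `B (c j) (c k)` to `⟨c j, c k⟩`.
  simp_rw [← Finset.sum_smul, b.sum_inner_mul_inner]
  classical
  simp [orthonormal_iff_ite.mp c.orthonormal]

/-- The diagonal sum of a bilinear map over an orthonormal basis of a subspace can be computed with
any orthonormal family spanning the subspace. -/
theorem sum_bilin_stdOrthonormalBasis_eq [FiniteDimensional ℝ E] {N : Type*} [AddCommGroup N]
    [Module ℝ N] {ι : Type*} [Fintype ι] {v : ι → E} (hv : Orthonormal ℝ v) {V : Submodule ℝ E}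
    (hV : Submodule.span ℝ (Set.range v) = V) (B : E →ₗ[ℝ] E →ₗ[ℝ] N) :
    ∑ i, B (stdOrthonormalBasis ℝ V i : E) (stdOrthonormalBasis ℝ V i : E)
      = ∑ i, B (v i) (v i) := by
  subst hV
  set V := Submodule.span ℝ (Set.range v)
  have hmem : ∀ i, v i ∈ V := fun i => Submodule.subset_span ⟨i, rfl⟩
  let w : ι → V := fun i => ⟨v i, hmem i⟩
  have hw : Orthonormal ℝ w := by
    classical
    rw [orthonormal_iff_ite] at hv ⊢
    exact hv
  have hspan : ⊤ ≤ Submodule.span ℝ (Set.range w) :=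
    (Submodule.span_range_subtype_eq_top_iff V hmem).mpr rfl |>.ge
  have := sum_bilin_orthonormalBasis_eq (stdOrthonormalBasis ℝ V)
    (OrthonormalBasis.mk hw hspan) (B.compl₁₂ V.subtype V.subtype)
  simpa [w] using this

/-- The frames of a subspace `D` which are orthonormal form a compact set. -/
theorem isCompact_orthonormal_frames [FiniteDimensional ℝ E] (D : Submodule ℝ E) (ι : Type*)
    [Fintype ι] : IsCompact {v : ι → E | Orthonormal ℝ v ∧ ∀ i, v i ∈ D} := by
  classical
  have : ProperSpace E := FiniteDimensional.proper ℝ E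
  refine Metric.isCompact_of_isClosed_isBounded ?_ ?_
  · have : {v : ι → E | Orthonormal ℝ v ∧ ∀ i, v i ∈ D} =
        (⋂ i, ⋂ j, {v : ι → E | inner ℝ (v i) (v j) = if i = j then (1 : ℝ) else 0}) ∩
          ⋂ i, (fun v : ι → E => v i) ⁻¹' (D : Set E) := by
      ext v
      simp [orthonormal_iff_ite]
    rw [this]
    refine IsClosed.inter (isClosed_iInter fun i => isClosed_iInter fun j => ?_)
      (isClosed_iInter fun i => ?_)
    · exact isClosed_eq (by fun_prop) continuous_const
    · exact D.closed_of_finiteDimensional.preimage (continuous_apply i)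
  · refine (Metric.isBounded_closedBall (x := (0 : ι → E)) (r := 1)).subset ?_
    intro v hv
    rw [mem_closedBall_zero_iff, pi_norm_le_iff_of_nonneg zero_le_one]
    exact fun i => (hv.1.1 i).le

/-- Nonemptiness of the compact set over which the maxima are taken; the bounds `∑ nᵢ ≤ d` and `s ≤
d` enter here. -/
theorem exists_orthonormal_frame [FiniteDimensional ℝ E] (D : Submodule ℝ E) (ι : Type*)
    [Fintype ι] (h : Fintype.card ι ≤ finrank ℝ D) :
    {v : ι → E | Orthonormal ℝ v ∧ ∀ i, v i ∈ D}.Nonempty := by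
  have : Nonempty (ι ↪ Fin (finrank ℝ D)) :=
    Function.Embedding.nonempty_of_card_le (by simpa using h)
  obtain ⟨e⟩ := this
  refine ⟨fun i => (stdOrthonormalBasis ℝ D (e i) : E), ?_, fun i => Subtype.coe_prop _⟩
  have h1 := (stdOrthonormalBasis ℝ D).orthonormal.comp e e.injective
  exact h1.comp_linearIsometry D.subtypeₗᵢ

theorem exists_orthonormal_span_eq [FiniteDimensional ℝ E] (V : Submodule ℝ E) {m : ℕ}
    (hV : finrank ℝ V = m) :
    ∃ v : Fin m → E, Orthonormal ℝ v ∧ Submodule.span ℝ (Set.range v) = V := by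
  subst hV
  refine ⟨fun i => (stdOrthonormalBasis ℝ V i : E),
    (stdOrthonormalBasis ℝ V).orthonormal.comp_linearIsometry V.subtypeₗᵢ, ?_⟩
  have h := congrArg (Submodule.map V.subtype) (stdOrthonormalBasis ℝ V).toBasis.span_eq
  rw [Submodule.map_span, ← Set.range_comp] at h
  simpa [Function.comp_def] using h

/-- Putting together orthonormal families in mutually orthogonal subspaces. -/
theorem orthonormal_sigma {k : ℕ} {ν : Fin k → ℕ} {v : ∀ i, Fin (ν i) → E}
    {V : Fin k → Submodule ℝ E} (hv : ∀ i, Orthonormal ℝ (v i)) (hmem : ∀ i a, v i a ∈ V i)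
    (hV : ∀ i j, i ≠ j → V i ⟂ V j) :
    Orthonormal ℝ (fun p : Σ i, Fin (ν i) => v p.1 p.2) := by
  refine ⟨fun p => (hv p.1).1 p.2, ?_⟩
  rintro ⟨i, a⟩ ⟨j, b⟩ hne
  by_cases hij : i = j
  · subst hij
    exact (hv i).2 (fun h : a = b => hne (by rw [h]))
  · exact (hV i j hij).inner_eq (hmem i a) (hmem j b)

variable {N : Type*} [NormedAddCommGroup N] [InnerProductSpace ℝ N]

/-- With one vector fixed, `gaussTerm` is the diagonal of a bilinear form in the other, so each
basis can be exchanged in turn. -/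
theorem sum_gaussTerm_stdOrthonormalBasis [FiniteDimensional ℝ E] (B : E →ₗ[ℝ] E →ₗ[ℝ] N)
    {ι κ : Type*} [Fintype ι] [Fintype κ] {v : ι → E} {w : κ → E} {V W : Submodule ℝ E}
    (hv : Orthonormal ℝ v) (hw : Orthonormal ℝ w)
    (hV : Submodule.span ℝ (Set.range v) = V) (hW : Submodule.span ℝ (Set.range w) = W) :
    ∑ a, ∑ b, gaussTerm B (stdOrthonormalBasis ℝ V a : E) (stdOrthonormalBasis ℝ W b : E)
      = ∑ a, ∑ b, gaussTerm B (v a) (w b) := by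
  have h1 : ∀ u, ∑ b, gaussTerm B u (stdOrthonormalBasis ℝ W b : E) = ∑ b, gaussTerm B u (w b) :=
    fun u => sum_bilin_stdOrthonormalBasis_eq hw hW (gaussForm' B u)
  have h2 : ∀ u, ∑ a, gaussTerm B (stdOrthonormalBasis ℝ V a : E) u = ∑ a, gaussTerm B (v a) u :=
    fun u => sum_bilin_stdOrthonormalBasis_eq hv hV (gaussForm B u)
  simp_rw [h1]
  rw [Finset.sum_comm]
  simp_rw [h2]
  rw [Finset.sum_comm]

/-- Expanding the first argument in a basis leaves finitely many linear maps of the second, each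
continuous in finite dimension. -/
theorem continuous_bilin [FiniteDimensional ℝ E] (B : E →ₗ[ℝ] E →ₗ[ℝ] N) {X : Type*}
    [TopologicalSpace X] {f g : X → E} (hf : Continuous f) (hg : Continuous g) :
    Continuous fun x => B (f x) (g x) := by
  have h : ∀ x, B (f x) (g x) = ∑ i, inner ℝ (stdOrthonormalBasis ℝ E i) (f x) •
      B (stdOrthonormalBasis ℝ E i) (g x) := by
    intro x
    conv_lhs => rw [← (stdOrthonormalBasis ℝ E).sum_repr' (f x)]
    simp
  simp_rw [h]
  refine continuous_finsetSum _ fun i _ => Continuous.smul (by fun_prop) ?_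
  exact (LinearMap.continuous_of_finiteDimensional (B (stdOrthonormalBasis ℝ E i))).comp hg

theorem continuous_gaussTerm [FiniteDimensional ℝ E] (B : E →ₗ[ℝ] E →ₗ[ℝ] N) {X : Type*}
    [TopologicalSpace X] {f g : X → E} (hf : Continuous f) (hg : Continuous g) :
    Continuous fun x => gaussTerm B (f x) (g x) :=
  ((continuous_bilin B hg hg).inner (continuous_bilin B hf hf)).sub
    ((continuous_bilin B hf hg).inner (continuous_bilin B hg hf))

end LinearAlgebra

end CRGeom

namespace CRGeom

/-! ### The Gauss equation for a map `F` from coordinate space into an inner product space. -/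

section Gauss

variable {n : ℕ} {N : Type*} [NormedAddCommGroup N] [InnerProductSpace ℝ N]

/-- The coordinate vector field `∂ᵢ F`. -/
noncomputable def firstDeriv (F : EuclideanSpace ℝ (Fin n) → N) (i : Fin n)
    (u : EuclideanSpace ℝ (Fin n)) : N :=
  fderiv ℝ F u (EuclideanSpace.single i 1)

/-- The second partial derivative `∂ᵢ ∂ⱼ F`. -/
noncomputable def secondDeriv (F : EuclideanSpace ℝ (Fin n) → N) (i j : Fin n)
    (u : EuclideanSpace ℝ (Fin n)) : N :=
  fderiv ℝ (firstDeriv F j) u (EuclideanSpace.single i 1)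

/-- The third partial derivative `∂ᵢ ∂ⱼ ∂ₖ F`. -/
noncomputable def thirdDeriv (F : EuclideanSpace ℝ (Fin n) → N) (i j k : Fin n)
    (u : EuclideanSpace ℝ (Fin n)) : N :=
  fderiv ℝ (secondDeriv F j k) u (EuclideanSpace.single i 1)

/-- The Gram matrix of the coordinate vector fields. -/
noncomputable def gram (F : EuclideanSpace ℝ (Fin n) → N) (u : EuclideanSpace ℝ (Fin n)) :
    Matrix (Fin n) (Fin n) ℝ :=
  Matrix.of fun i j => inner ℝ (firstDeriv F i u) (firstDeriv F j u)

theorem contDiffAt_fderiv_apply {F : EuclideanSpace ℝ (Fin n) → N} {u : EuclideanSpace ℝ (Fin n)}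
    (hF : ContDiffAt ℝ ∞ F u) (w : EuclideanSpace ℝ (Fin n)) :
    ContDiffAt ℝ ∞ (fun u => fderiv ℝ F u w) u :=
  (hF.fderiv_right (m := ∞) (by simp)).clm_apply contDiffAt_const

variable {F : EuclideanSpace ℝ (Fin n) → N} {u : EuclideanSpace ℝ (Fin n)}

theorem contDiffAt_firstDeriv (hF : ContDiffAt ℝ ∞ F u) (i : Fin n) :
    ContDiffAt ℝ ∞ (firstDeriv F i) u :=
  contDiffAt_fderiv_apply hF _

theorem contDiffAt_secondDeriv (hF : ContDiffAt ℝ ∞ F u) (i j : Fin n) :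
    ContDiffAt ℝ ∞ (secondDeriv F i j) u :=
  contDiffAt_fderiv_apply (contDiffAt_firstDeriv hF j) _

theorem fderiv_fderiv_apply_comm (hF : ContDiffAt ℝ ∞ F u) (v w : EuclideanSpace ℝ (Fin n)) :
    fderiv ℝ (fun u => fderiv ℝ F u w) u v = fderiv ℝ (fun u => fderiv ℝ F u v) u w := by
  have hd : DifferentiableAt ℝ (fderiv ℝ F) u :=
    (hF.fderiv_right (m := ∞) (by simp)).differentiableAt (by simp)
  have hsymm : IsSymmSndFDerivAt ℝ F u := hF.isSymmSndFDerivAt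
    (by rw [minSmoothness_of_isRCLikeNormedField]; exact WithTop.coe_le_coe.mpr le_top)
  rw [fderiv_clm_apply hd (differentiableAt_const _), fderiv_clm_apply hd (differentiableAt_const _)]
  simpa using hsymm.eq v w

theorem secondDeriv_comm (hF : ContDiffAt ℝ ∞ F u) (i j : Fin n) :
    secondDeriv F i j u = secondDeriv F j i u :=
  fderiv_fderiv_apply_comm hF _ _

/-- This symmetry makes the third derivatives cancel in the curvature. -/
theorem thirdDeriv_comm (hF : ContDiffAt ℝ ∞ F u) (i j k : Fin n) :
    thirdDeriv F i j k u = thirdDeriv F j i k u :=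
  fderiv_fderiv_apply_comm (contDiffAt_firstDeriv hF k) _ _

theorem pderiv_inner {f g : EuclideanSpace ℝ (Fin n) → N} (hf : DifferentiableAt ℝ f u)
    (hg : DifferentiableAt ℝ g u) (i : Fin n) :
    pderiv i (fun w => inner ℝ (f w) (g w)) u
      = inner ℝ (f u) (fderiv ℝ g u (EuclideanSpace.single i 1))
        + inner ℝ (fderiv ℝ f u (EuclideanSpace.single i 1)) (g u) :=
  fderiv_inner_apply ℝ hf hg _

theorem pderiv_gram (hF : ContDiffAt ℝ ∞ F u) (i j l : Fin n) :
    pderiv i (fun w => gram F w j l) u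
      = inner ℝ (firstDeriv F j u) (secondDeriv F i l u)
        + inner ℝ (secondDeriv F i j u) (firstDeriv F l u) :=
  pderiv_inner ((contDiffAt_firstDeriv hF j).differentiableAt (by simp))
    ((contDiffAt_firstDeriv hF l).differentiableAt (by simp)) i

theorem differentiableAt_gram (hF : ContDiffAt ℝ ∞ F u) (i j : Fin n) :
    DifferentiableAt ℝ (fun w => gram F w i j) u :=
  ((contDiffAt_firstDeriv hF i).differentiableAt (by simp)).inner ℝ
    ((contDiffAt_firstDeriv hF j).differentiableAt (by simp))

theorem differentiableAt_det {E : Type*} [NormedAddCommGroup E] [NormedSpace ℝ E]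
    {A : E → Matrix (Fin n) (Fin n) ℝ} {u : E}
    (hA : ∀ i j, DifferentiableAt ℝ (fun w => A w i j) u) :
    DifferentiableAt ℝ (fun w => (A w).det) u := by
  simp only [Matrix.det_apply]
  refine DifferentiableAt.fun_sum fun σ _ => DifferentiableAt.fun_const_smul ?_ _
  have h : ∀ s : Finset (Fin n), DifferentiableAt ℝ (fun w => ∏ i ∈ s, A w (σ i) i) u := by
    intro s
    induction s using Finset.induction_on with
    | empty => simp
    | insert a s ha ih =>
      simp only [Finset.prod_insert ha]
      exact (hA _ _).mul ih
  exact h _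

/-- Cramer's rule: an entry of the inverse is a determinant divided by `det A`. -/
theorem differentiableAt_inv {E : Type*} [NormedAddCommGroup E] [NormedSpace ℝ E]
    {A : E → Matrix (Fin n) (Fin n) ℝ} {u : E}
    (hA : ∀ i j, DifferentiableAt ℝ (fun w => A w i j) u) (hdet : (A u).det ≠ 0) (i j : Fin n) :
    DifferentiableAt ℝ (fun w => (A w)⁻¹ i j) u := by
  simp only [Matrix.inv_def, Matrix.smul_apply, Ring.inverse_eq_inv', smul_eq_mul,
    Matrix.adjugate_apply]
  refine DifferentiableAt.mul ((differentiableAt_det hA).inv hdet) (differentiableAt_det ?_)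
  intro a b
  by_cases h : a = j
  · subst h
    simp
  · simpa [Matrix.updateRow_ne h] using hA a b

/-- The Christoffel symbols of the metric induced by `F`. -/
noncomputable def inducedChristoffel (F : EuclideanSpace ℝ (Fin n) → N) (k i j : Fin n)
    (u : EuclideanSpace ℝ (Fin n)) : ℝ :=
  ∑ l, (gram F u)⁻¹ k l * inner ℝ (secondDeriv F i j u) (firstDeriv F l u)

/-- The three metric derivatives give six inner products; by symmetry of second derivatives four
cancel and two agree. -/
theorem half_sum_pderiv_gram (hF : ContDiffAt ℝ ∞ F u) (k i j : Fin n) :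
    (1 / 2) * ∑ l, (gram F u)⁻¹ k l *
      (pderiv i (fun w => gram F w j l) u + pderiv j (fun w => gram F w i l) u
        - pderiv l (fun w => gram F w i j) u) = inducedChristoffel F k i j u := by
  rw [inducedChristoffel, Finset.mul_sum]
  refine Finset.sum_congr rfl fun l _ => ?_
  rw [pderiv_gram hF, pderiv_gram hF, pderiv_gram hF, secondDeriv_comm hF j i,
    secondDeriv_comm hF l i, secondDeriv_comm hF l j,
    real_inner_comm (secondDeriv F j l u) (firstDeriv F i u),
    real_inner_comm (secondDeriv F i l u) (firstDeriv F j u)]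
  ring

/-- Lowering the index removes the inverse matrix, so this identity can be differentiated without a
formula for the derivative of `g⁻¹`. -/
theorem sum_gram_mul_inducedChristoffel (hdet : (gram F u).det ≠ 0) (m i j : Fin n) :
    ∑ l, gram F u m l * inducedChristoffel F l i j u
      = inner ℝ (secondDeriv F i j u) (firstDeriv F m u) := by
  have h : gram F u * (gram F u)⁻¹ = 1 :=
    Matrix.mul_nonsing_inv _ (isUnit_iff_ne_zero.mpr hdet)
  simp only [inducedChristoffel, Finset.mul_sum]
  rw [Finset.sum_comm]
  simp_rw [← mul_assoc, ← Finset.sum_mul, ← Matrix.mul_apply, h, Matrix.one_apply]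
  simp

theorem gram_comm (i j : Fin n) : gram F u i j = gram F u j i :=
  real_inner_comm _ _

theorem differentiableAt_inducedChristoffel (hF : ContDiffAt ℝ ∞ F u)
    (hdet : (gram F u).det ≠ 0) (k i j : Fin n) :
    DifferentiableAt ℝ (inducedChristoffel F k i j) u := by
  unfold inducedChristoffel
  refine DifferentiableAt.fun_sum fun l _ => ?_
  refine (differentiableAt_inv (differentiableAt_gram hF) hdet k l).mul ?_
  exact ((contDiffAt_secondDeriv hF i j).differentiableAt (by simp)).inner ℝ
    ((contDiffAt_firstDeriv hF l).differentiableAt (by simp))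

/-- The normal component of the second derivative `∂ᵢ ∂ⱼ F`. -/
noncomputable def normalPart (F : EuclideanSpace ℝ (Fin n) → N) (i j : Fin n)
    (u : EuclideanSpace ℝ (Fin n)) : N :=
  secondDeriv F i j u - ∑ l, inducedChristoffel F l i j u • firstDeriv F l u

/-- The Christoffel symbols solve the normal equations for projecting `∂ᵢ∂ⱼF` onto the tangent
space. -/
theorem inner_normalPart_firstDeriv (hdet : (gram F u).det ≠ 0) (i j m : Fin n) :
    inner ℝ (normalPart F i j u) (firstDeriv F m u) = 0 := by
  rw [normalPart, inner_sub_left, sum_inner, ← sum_gram_mul_inducedChristoffel hdet, sub_eq_zero]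
  refine Finset.sum_congr rfl fun l _ => ?_
  rw [real_inner_smul_left, mul_comm, gram_comm]
  rfl

theorem inner_normalPart (hdet : (gram F u).det ≠ 0) (i j k m : Fin n) :
    inner ℝ (normalPart F i j u) (normalPart F k m u)
      = inner ℝ (secondDeriv F i j u) (secondDeriv F k m u)
        - ∑ l, inducedChristoffel F l i j u *
          inner ℝ (firstDeriv F l u) (secondDeriv F k m u) := by
  -- Only the right factor is expanded at first: its tangential terms vanish against the normal left
  -- factor.
  conv_lhs => rw [normalPart.eq_1 F k m]
  rw [inner_sub_right, inner_sum]
  simp only [real_inner_smul_right, inner_normalPart_firstDeriv hdet, mul_zero,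
    Finset.sum_const_zero, sub_zero]
  rw [normalPart, inner_sub_left, sum_inner]
  simp only [real_inner_smul_left]

/-- The product rule applied to `∑ₗ gₘₗ Γˡⱼₖ = ⟨∂ⱼ∂ₖF, ∂ₘF⟩`. The identity is needed on a
neighbourhood, hence the eventual form of `hdet`. -/
theorem sum_gram_mul_pderiv_inducedChristoffel (hF : ContDiffAt ℝ ∞ F u)
    (hdet : ∀ᶠ w in nhds u, (gram F w).det ≠ 0) (m i j k : Fin n) :
    ∑ l, gram F u m l * pderiv i (inducedChristoffel F l j k) u
      = inner ℝ (thirdDeriv F i j k u) (firstDeriv F m u)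
        + inner ℝ (normalPart F j k u) (normalPart F i m u)
        - ∑ l, inducedChristoffel F l j k u *
          ∑ p, gram F u m p * inducedChristoffel F p i l u := by
  have hd := hdet.self_of_nhds
  have h1 : pderiv i (fun w => ∑ l, gram F w m l * inducedChristoffel F l j k w) u
      = pderiv i (fun w => inner ℝ (secondDeriv F j k w) (firstDeriv F m w)) u := by
    unfold pderiv
    rw [Filter.EventuallyEq.fderiv_eq]
    exact hdet.mono fun w hw => sum_gram_mul_inducedChristoffel hw m j k
  have h2 : pderiv i (fun w => ∑ l, gram F w m l * inducedChristoffel F l j k w) u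
      = ∑ l, (gram F u m l * pderiv i (inducedChristoffel F l j k) u
        + inducedChristoffel F l j k u * pderiv i (fun w => gram F w m l) u) := by
    unfold pderiv
    rw [fderiv_fun_sum fun l _ => (differentiableAt_gram hF m l).fun_mul
      (differentiableAt_inducedChristoffel hF hd l j k), sum_apply]
    refine Finset.sum_congr rfl fun l _ => ?_
    rw [fderiv_fun_mul (differentiableAt_gram hF m l)
      (differentiableAt_inducedChristoffel hF hd l j k)]
    simp
  have h3 := pderiv_inner ((contDiffAt_secondDeriv hF j k).differentiableAt (by simp))
    ((contDiffAt_firstDeriv hF m).differentiableAt (by simp)) i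
  rw [h1, h3, Finset.sum_add_distrib] at h2
  rw [inner_normalPart hd]
  simp only [sum_gram_mul_inducedChristoffel hd]
  have h4 : ∑ l, inducedChristoffel F l j k u * pderiv i (fun w => gram F w m l) u
      = ∑ l, inducedChristoffel F l j k u * inner ℝ (firstDeriv F l u) (secondDeriv F i m u)
        + ∑ l, inducedChristoffel F l j k u *
          inner ℝ (secondDeriv F i l u) (firstDeriv F m u) := by
    rw [← Finset.sum_add_distrib]
    refine Finset.sum_congr rfl fun l _ => ?_
    rw [pderiv_gram hF, ← mul_add, real_inner_comm (firstDeriv F m u),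
      real_inner_comm (firstDeriv F l u) (secondDeriv F i m u), add_comm]
  rw [h4] at h2
  unfold thirdDeriv
  change inner ℝ (secondDeriv F j k u) (secondDeriv F i m u) + _ = _ at h2
  linarith

/-- The components of the curvature tensor of the metric induced by `F`. -/
noncomputable def inducedCurvature (F : EuclideanSpace ℝ (Fin n) → N) (l i j k : Fin n)
    (u : EuclideanSpace ℝ (Fin n)) : ℝ :=
  pderiv i (inducedChristoffel F l j k) u - pderiv j (inducedChristoffel F l i k) u
    + ∑ m, (inducedChristoffel F m j k u * inducedChristoffel F l i m u
      - inducedChristoffel F m i k u * inducedChristoffel F l j m u)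

/-- The Gauss equation in coordinates. -/
theorem gauss_equation (hF : ContDiffAt ℝ ∞ F u)
    (hdet : ∀ᶠ w in nhds u, (gram F w).det ≠ 0) (i j k m : Fin n) :
    ∑ l, inducedCurvature F l i j k u * gram F u l m
      = inner ℝ (normalPart F j k u) (normalPart F i m u)
        - inner ℝ (normalPart F i k u) (normalPart F j m u) := by
  have h1 := sum_gram_mul_pderiv_inducedChristoffel hF hdet m i j k
  have h2 := sum_gram_mul_pderiv_inducedChristoffel hF hdet m j i k
  rw [thirdDeriv_comm hF j i k] at h2
  -- The quadratic Christoffel terms of the curvature are exactly those subtracted in `h1` and `h2`,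
  -- so only the normal parts survive.
  have h3 : ∀ i j, ∑ l, (∑ p, inducedChristoffel F p j k u * inducedChristoffel F l i p u) *
      gram F u m l = ∑ l, inducedChristoffel F l j k u *
          ∑ p, gram F u m p * inducedChristoffel F p i l u := by
    intro i j
    simp only [Finset.sum_mul, Finset.mul_sum]
    rw [Finset.sum_comm]
    exact Finset.sum_congr rfl fun _ _ => Finset.sum_congr rfl fun _ _ => by ring
  have h4 : ∑ l, inducedCurvature F l i j k u * gram F u l m
      = ∑ l, gram F u m l * pderiv i (inducedChristoffel F l j k) u
        - ∑ l, gram F u m l * pderiv j (inducedChristoffel F l i k) u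
        + (∑ l, (∑ p, inducedChristoffel F p j k u * inducedChristoffel F l i p u) * gram F u m l
        - ∑ l, (∑ p, inducedChristoffel F p i k u * inducedChristoffel F l j p u) *
          gram F u m l) := by
    simp only [← Finset.sum_sub_distrib, ← Finset.sum_add_distrib]
    refine Finset.sum_congr rfl fun l _ => ?_
    rw [inducedCurvature, gram_comm l m, Finset.sum_sub_distrib]
    ring
  rw [h4, h3, h3, h1, h2]
  ring

/-- The Gram matrix of an immersion is invertible. -/
theorem det_gram_ne_zero (h : Function.Injective (fderiv ℝ F u)) : (gram F u).det ≠ 0 := by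
  intro h0
  obtain ⟨c, hc, hc0⟩ := Matrix.exists_mulVec_eq_zero_iff.mpr h0
  -- The squared norm of this vector is `cᵀ G c`, with `G c = 0`.
  have hz : ∑ j, c j • firstDeriv F j u = 0 := by
    rw [← inner_self_eq_zero (𝕜 := ℝ), sum_inner]
    refine Finset.sum_eq_zero fun i _ => ?_
    have h1 := congrFun hc0 i
    rw [real_inner_smul_left, inner_sum]
    simp only [Matrix.mulVec, dotProduct, Pi.zero_apply] at h1
    simp only [real_inner_smul_right]
    rw [mul_eq_zero]
    right
    rw [← h1]
    exact Finset.sum_congr rfl fun j _ => mul_comm _ _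
  apply hc
  have h2 : fderiv ℝ F u (∑ j, c j • EuclideanSpace.single j (1 : ℝ)) = 0 := by
    simpa [firstDeriv] using hz
  have h3 := h (h2.trans (map_zero _).symm)
  ext j
  simpa [Finset.sum_apply, Pi.single_apply] using congrArg (fun v => v j) h3

theorem fderiv_apply_eq_sum (w : EuclideanSpace ℝ (Fin n)) :
    fderiv ℝ F u w = ∑ i, w i • firstDeriv F i u := by
  have hw : w = ∑ i, w i • EuclideanSpace.single i (1 : ℝ) := by
    ext j
    simp [Pi.single_apply]
  conv_lhs => rw [hw]
  simp [firstDeriv]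

theorem fderiv_fderiv_apply_eq_sum (hF : ContDiffAt ℝ ∞ F u) (v w : EuclideanSpace ℝ (Fin n)) :
    fderiv ℝ (fun u => fderiv ℝ F u w) u v = ∑ i, ∑ j, (v i * w j) • secondDeriv F i j u := by
  have h : (fun u => fderiv ℝ F u w) = fun u => ∑ j, w j • firstDeriv F j u :=
    funext fun _ => fderiv_apply_eq_sum w
  have hd : ∀ j, DifferentiableAt ℝ (firstDeriv F j) u := fun j =>
    (contDiffAt_firstDeriv hF j).differentiableAt (by simp)
  rw [h, fderiv_apply_eq_sum]
  refine Finset.sum_congr rfl fun i _ => ?_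
  rw [firstDeriv, fderiv_fun_sum fun j _ => (hd j).fun_const_smul _, sum_apply,
    Finset.smul_sum]
  refine Finset.sum_congr rfl fun j _ => ?_
  rw [fderiv_fun_const_smul (hd j), mul_smul]
  rfl

/-- The normal part is the orthogonal projection of the second derivative. -/
theorem starProjection_secondDeriv (hdet : (gram F u).det ≠ 0) (K : Submodule ℝ N)
    [Kᗮ.HasOrthogonalProjection]
    (hK : ∀ v, v ∈ K ↔ ∃ w, fderiv ℝ F u w = v) (i j : Fin n) :
    Kᗮ.starProjection (secondDeriv F i j u) = normalPart F i j u := by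
  refine Submodule.eq_starProjection_of_mem_orthogonal (K := Kᗮ) ?_ ?_
  · rw [Submodule.mem_orthogonal']
    intro v hv
    obtain ⟨w, rfl⟩ := (hK v).mp hv
    rw [fderiv_apply_eq_sum, inner_sum]
    simp [real_inner_smul_right, inner_normalPart_firstDeriv hdet]
  · apply Submodule.le_orthogonal_orthogonal K
    rw [normalPart, sub_sub_cancel]
    exact Submodule.sum_mem _ fun l _ => K.smul_mem _ ((hK _).mpr ⟨_, rfl⟩)

theorem inner_sum_smul_sum_smul (a b c d : Fin n → ℝ) (P : Fin n → Fin n → N) :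
    inner ℝ (∑ i, ∑ j, (a i * b j) • P i j) (∑ k, ∑ m, (c k * d m) • P k m)
      = ∑ i, ∑ j, ∑ k, ∑ m, a i * b j * c k * d m * inner ℝ (P i j) (P k m) := by
  rw [sum_inner]
  refine Finset.sum_congr rfl fun i _ => ?_
  rw [sum_inner]
  refine Finset.sum_congr rfl fun j _ => ?_
  rw [inner_sum]
  refine Finset.sum_congr rfl fun k _ => ?_
  rw [inner_sum]
  refine Finset.sum_congr rfl fun m _ => ?_
  rw [real_inner_smul_left, real_inner_smul_right]
  ring

/-- Passes from the Gauss equation on coordinate vectors to arbitrary tangent vectors. -/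
theorem sum_mul_inner_sub_inner (a b c d : Fin n → ℝ) (P : Fin n → Fin n → N) :
    ∑ i, ∑ j, ∑ k, ∑ m, a i * b j * c k * d m *
        (inner ℝ (P j k) (P i m) - inner ℝ (P i k) (P j m))
      = inner ℝ (∑ i, ∑ j, (b i * c j) • P i j) (∑ k, ∑ m, (a k * d m) • P k m)
        - inner ℝ (∑ i, ∑ j, (a i * c j) • P i j) (∑ k, ∑ m, (b k * d m) • P k m) := by
  rw [inner_sum_smul_sum_smul, inner_sum_smul_sum_smul]
  simp only [mul_sub, Finset.sum_sub_distrib]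
  congr 1
  · rw [Finset.sum_comm]
    refine Finset.sum_congr rfl fun j _ => ?_
    rw [Finset.sum_comm]
    exact Finset.sum_congr rfl fun k _ => Finset.sum_congr rfl fun i _ =>
      Finset.sum_congr rfl fun m _ => by ring
  · refine Finset.sum_congr rfl fun i _ => ?_
    rw [Finset.sum_comm]
    exact Finset.sum_congr rfl fun k _ => Finset.sum_congr rfl fun j _ =>
      Finset.sum_congr rfl fun m _ => by ring

end Gauss

end CRGeom

namespace CRGeom

/-! ### Transfer to an isometric immersion through charts. -/

section Immersion

variable {n q : ℕ} {M : Type*} [TopologicalSpace M] [ChartedSpace (EuclideanSpace ℝ (Fin n)) M]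

/-- The expression of `f` in the chart at `x`. -/
noncomputable def localExpr (f : M → EuclideanSpace ℂ (Fin q)) (x : M) :
    EuclideanSpace ℝ (Fin n) → EuclideanSpace ℂ (Fin q) :=
  f ∘ (extChartAt (𝓡 n) x).symm

variable {f : M → EuclideanSpace ℂ (Fin q)}

theorem coords_add (x : M) (v w : TangentSpace (𝓡 n) x) :
    coords x (v + w) = coords x v + coords x w :=
  map_add _ _ _

theorem coords_smul (x : M) (c : ℝ) (v : TangentSpace (𝓡 n) x) :
    coords x (c • v) = c • coords x v :=
  map_smul _ _ _

/-- The second fundamental form as a bilinear map. -/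
noncomputable def secondFundamentalBilin (f : M → EuclideanSpace ℂ (Fin q)) (x : M) :
    TangentSpace (𝓡 n) x →ₗ[ℝ] TangentSpace (𝓡 n) x →ₗ[ℝ] EuclideanSpace ℂ (Fin q) :=
  LinearMap.mk₂ ℝ (fun v w => ∑ i, ∑ j, (coords x v i * coords x w j) •
      normalPart (localExpr f x) i j (extChartAt (𝓡 n) x x))
    (fun v v' w => by
      simp only [coords_add, PiLp.add_apply, add_mul, add_smul, Finset.sum_add_distrib])
    (fun c v w => by
      simp only [coords_smul, PiLp.smul_apply, smul_eq_mul, mul_assoc, mul_smul,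
        Finset.smul_sum])
    (fun v w w' => by
      simp only [coords_add, PiLp.add_apply, mul_add, add_smul, Finset.sum_add_distrib])
    (fun c v w => by
      simp only [coords_smul, PiLp.smul_apply, smul_eq_mul, mul_left_comm _ c, mul_smul c,
        Finset.smul_sum])

theorem secondFundamentalBilin_apply (x : M) (v w : TangentSpace (𝓡 n) x) :
    secondFundamentalBilin f x v w = ∑ i, ∑ j, (coords x v i * coords x w j) •
      normalPart (localExpr f x) i j (extChartAt (𝓡 n) x x) :=
  rfl

theorem differential_injective [RiemannianBundle (fun x : M => TangentSpace (𝓡 n) x)]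
    (hiso : ∀ (x : M) (v w : TangentSpace (𝓡 n) x),
      inner ℝ (differential n f x v) (differential n f x w) = inner ℝ v w) (x : M) :
    Function.Injective (differential n f x) := by
  refine (injective_iff_map_eq_zero _).mpr fun v hv => ?_
  rw [← inner_self_eq_zero (𝕜 := ℝ), ← hiso, hv, inner_zero_left]

variable [IsManifold (𝓡 n) ∞ M]

theorem contMDiffAt_extChartAt_symm (x : M) {u : EuclideanSpace ℝ (Fin n)}
    (hu : u ∈ (extChartAt (𝓡 n) x).target) :
    ContMDiffAt 𝓘(ℝ, EuclideanSpace ℝ (Fin n)) (𝓡 n) ∞ (extChartAt (𝓡 n) x).symm u :=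
  (contMDiffOn_extChartAt_symm (n := ∞) x).contMDiffAt
    ((isOpen_extChartAt_target (I := 𝓡 n) x).mem_nhds hu)

theorem contDiffAt_localExpr (hf : ContMDiff (𝓡 n) 𝓘(ℝ, EuclideanSpace ℂ (Fin q)) ∞ f) (x : M)
    {u : EuclideanSpace ℝ (Fin n)} (hu : u ∈ (extChartAt (𝓡 n) x).target) :
    ContDiffAt ℝ ∞ (localExpr f x) u :=
  ((hf _).comp u (contMDiffAt_extChartAt_symm x hu)).contDiffAt

theorem fderiv_localExpr_apply (hf : ContMDiff (𝓡 n) 𝓘(ℝ, EuclideanSpace ℂ (Fin q)) ∞ f) (x : M)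
    {u : EuclideanSpace ℝ (Fin n)} (hu : u ∈ (extChartAt (𝓡 n) x).target)
    (w : EuclideanSpace ℝ (Fin n)) :
    fderiv ℝ (localExpr f x) u w = differential n f ((extChartAt (𝓡 n) x).symm u)
      (mfderiv 𝓘(ℝ, EuclideanSpace ℝ (Fin n)) (𝓡 n) (extChartAt (𝓡 n) x).symm u w) := by
  rw [← mfderiv_eq_fderiv, localExpr, mfderiv_comp u ((hf _).mdifferentiableAt (by simp))
    ((contMDiffAt_extChartAt_symm x hu).mdifferentiableAt (by simp))]
  rfl

theorem bijective_mfderiv_extChartAt_symm (x : M) {u : EuclideanSpace ℝ (Fin n)}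
    (hu : u ∈ (extChartAt (𝓡 n) x).target) :
    Function.Bijective
      (mfderiv 𝓘(ℝ, EuclideanSpace ℝ (Fin n)) (𝓡 n) (extChartAt (𝓡 n) x).symm u) := by
  have : IsManifold (𝓡 n) 1 M := IsManifold.of_le (n := ∞) (by simp)
  have h := isInvertible_mfderivWithin_extChartAt_symm (I := 𝓡 n) (x := x) hu
  rw [ModelWithCorners.range_eq_univ, mfderivWithin_univ] at h
  exact h.bijective

/-- The differential of the inverse chart is onto `T_x M`, so `df_x` and the derivative of the local
expression have the same range. -/
theorem mem_tangentImage_iff (hf : ContMDiff (𝓡 n) 𝓘(ℝ, EuclideanSpace ℂ (Fin q)) ∞ f) (x : M)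
    (v : EuclideanSpace ℂ (Fin q)) :
    v ∈ tangentImage n f x ↔ ∃ w, fderiv ℝ (localExpr f x) (extChartAt (𝓡 n) x x) w = v := by
  have hu := mem_extChartAt_target (I := 𝓡 n) x
  have hbij := bijective_mfderiv_extChartAt_symm x hu
  simp only [fderiv_localExpr_apply hf x hu]
  rw [extChartAt_to_inv (I := 𝓡 n) x] at hbij ⊢
  constructor
  · rintro ⟨w, rfl⟩
    obtain ⟨w', rfl⟩ := hbij.surjective w
    exact ⟨w', rfl⟩
  · rintro ⟨w, rfl⟩
    exact ⟨_, rfl⟩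

theorem secondFundamentalBilin_comm
    (hf : ContMDiff (𝓡 n) 𝓘(ℝ, EuclideanSpace ℂ (Fin q)) ∞ f) (x : M)
    (v w : TangentSpace (𝓡 n) x) :
    secondFundamentalBilin f x v w = secondFundamentalBilin f x w v := by
  have hF := contDiffAt_localExpr hf x (mem_extChartAt_target (I := 𝓡 n) x)
  rw [secondFundamentalBilin_apply, secondFundamentalBilin_apply, Finset.sum_comm]
  refine Finset.sum_congr rfl fun i _ => Finset.sum_congr rfl fun j _ => ?_
  rw [mul_comm]
  congr 1
  simp only [normalPart, inducedChristoffel, secondDeriv_comm hF i j]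

variable [RiemannianBundle (fun x : M => TangentSpace (𝓡 n) x)]

/-- Needed on the whole chart target, not just at `x`, because the curvature differentiates the
metric. -/
theorem metricMatrix_eq_gram (hf : ContMDiff (𝓡 n) 𝓘(ℝ, EuclideanSpace ℂ (Fin q)) ∞ f)
    (hiso : ∀ (x : M) (v w : TangentSpace (𝓡 n) x),
      inner ℝ (differential n f x v) (differential n f x w) = inner ℝ v w) (x : M)
    {u : EuclideanSpace ℝ (Fin n)} (hu : u ∈ (extChartAt (𝓡 n) x).target) :
    metricMatrix x u = gram (localExpr f x) u := by
  ext i j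
  simp only [metricMatrix, gram, Matrix.of_apply, firstDeriv, fderiv_localExpr_apply hf x hu]
  exact (hiso _ _ _).symm

theorem det_gram_localExpr_ne_zero
    (hf : ContMDiff (𝓡 n) 𝓘(ℝ, EuclideanSpace ℂ (Fin q)) ∞ f)
    (hiso : ∀ (x : M) (v w : TangentSpace (𝓡 n) x),
      inner ℝ (differential n f x v) (differential n f x w) = inner ℝ v w) (x : M)
    {u : EuclideanSpace ℝ (Fin n)} (hu : u ∈ (extChartAt (𝓡 n) x).target) :
    (gram (localExpr f x) u).det ≠ 0 := by
  refine det_gram_ne_zero fun w w' h => ?_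
  rw [fderiv_localExpr_apply hf x hu, fderiv_localExpr_apply hf x hu] at h
  exact (bijective_mfderiv_extChartAt_symm x hu).injective (differential_injective hiso _ h)

theorem christoffel_eq (hf : ContMDiff (𝓡 n) 𝓘(ℝ, EuclideanSpace ℂ (Fin q)) ∞ f)
    (hiso : ∀ (x : M) (v w : TangentSpace (𝓡 n) x),
      inner ℝ (differential n f x v) (differential n f x w) = inner ℝ v w) (x : M)
    {u : EuclideanSpace ℝ (Fin n)} (hu : u ∈ (extChartAt (𝓡 n) x).target) (k i j : Fin n) :
    christoffel x k i j u = inducedChristoffel (localExpr f x) k i j u := by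
  have h : ∀ a b c, pderiv a (fun w => metricMatrix x w b c) u
      = pderiv a (fun w => gram (localExpr f x) w b c) u := by
    intro a b c
    unfold pderiv
    rw [Filter.EventuallyEq.fderiv_eq]
    filter_upwards [(isOpen_extChartAt_target (I := 𝓡 n) x).mem_nhds hu] with w hw
    rw [metricMatrix_eq_gram hf hiso x hw]
  rw [christoffel, ← half_sum_pderiv_gram (contDiffAt_localExpr hf x hu)]
  simp only [h, metricMatrix_eq_gram hf hiso x hu]

theorem curvatureCoeff_eq (hf : ContMDiff (𝓡 n) 𝓘(ℝ, EuclideanSpace ℂ (Fin q)) ∞ f)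
    (hiso : ∀ (x : M) (v w : TangentSpace (𝓡 n) x),
      inner ℝ (differential n f x v) (differential n f x w) = inner ℝ v w) (x : M)
    {u : EuclideanSpace ℝ (Fin n)} (hu : u ∈ (extChartAt (𝓡 n) x).target) (l i j k : Fin n) :
    curvatureCoeff x l i j k u = inducedCurvature (localExpr f x) l i j k u := by
  have h : ∀ a b c d, pderiv a (christoffel x b c d) u
      = pderiv a (inducedChristoffel (localExpr f x) b c d) u := by
    intro a b c d
    unfold pderiv
    rw [Filter.EventuallyEq.fderiv_eq]
    filter_upwards [(isOpen_extChartAt_target (I := 𝓡 n) x).mem_nhds hu] with w hw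
    exact christoffel_eq hf hiso x hw b c d
  simp only [curvatureCoeff, inducedCurvature, h, christoffel_eq hf hiso x hu]

theorem secondFundamentalForm_eq (hf : ContMDiff (𝓡 n) 𝓘(ℝ, EuclideanSpace ℂ (Fin q)) ∞ f)
    (hiso : ∀ (x : M) (v w : TangentSpace (𝓡 n) x),
      inner ℝ (differential n f x v) (differential n f x w) = inner ℝ v w) (x : M)
    (v w : TangentSpace (𝓡 n) x) :
    secondFundamentalForm n f x v w = secondFundamentalBilin f x v w := by
  have hu := mem_extChartAt_target (I := 𝓡 n) x
  rw [secondFundamentalForm, secondFundamentalBilin_apply]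
  have h := fderiv_fderiv_apply_eq_sum (contDiffAt_localExpr hf x hu) (coords x v) (coords x w)
  unfold localExpr at h
  rw [h]
  simp only [map_sum, map_smul]
  refine Finset.sum_congr rfl fun i _ => Finset.sum_congr rfl fun j _ => ?_
  congr 1
  exact starProjection_secondDeriv (det_gram_localExpr_ne_zero hf hiso x hu) _
    (mem_tangentImage_iff hf x) i j

/-- The Gauss equation. -/
theorem riemann_eq (hf : ContMDiff (𝓡 n) 𝓘(ℝ, EuclideanSpace ℂ (Fin q)) ∞ f)
    (hiso : ∀ (x : M) (v w : TangentSpace (𝓡 n) x),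
      inner ℝ (differential n f x v) (differential n f x w) = inner ℝ v w) (x : M)
    (X Y Z W : TangentSpace (𝓡 n) x) :
    riemann x X Y Z W
      = inner ℝ (secondFundamentalBilin f x Y Z) (secondFundamentalBilin f x X W)
        - inner ℝ (secondFundamentalBilin f x X Z) (secondFundamentalBilin f x Y W) := by
  have hu := mem_extChartAt_target (I := 𝓡 n) x
  have hG : ∀ i j k m, ∑ l, curvatureCoeff x l i j k (extChartAt (𝓡 n) x x) *
      metricMatrix x (extChartAt (𝓡 n) x x) l m
      = inner ℝ (normalPart (localExpr f x) j k (extChartAt (𝓡 n) x x))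
          (normalPart (localExpr f x) i m (extChartAt (𝓡 n) x x))
        - inner ℝ (normalPart (localExpr f x) i k (extChartAt (𝓡 n) x x))
          (normalPart (localExpr f x) j m (extChartAt (𝓡 n) x x)) := by
    intro i j k m
    simp only [curvatureCoeff_eq hf hiso x hu, metricMatrix_eq_gram hf hiso x hu]
    refine gauss_equation (contDiffAt_localExpr hf x hu) ?_ i j k m
    filter_upwards [(isOpen_extChartAt_target (I := 𝓡 n) x).mem_nhds hu] with w hw
    exact det_gram_localExpr_ne_zero hf hiso x hw
  rw [secondFundamentalBilin_apply, secondFundamentalBilin_apply, secondFundamentalBilin_apply,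
    secondFundamentalBilin_apply, ← sum_mul_inner_sub_inner]
  unfold riemann
  refine Finset.sum_congr rfl fun i _ => Finset.sum_congr rfl fun j _ =>
    Finset.sum_congr rfl fun k _ => ?_
  -- Makes `l`, the index contracted with the metric, innermost so that `hG` applies.
  rw [Finset.sum_comm]
  refine Finset.sum_congr rfl fun m _ => ?_
  rw [← hG, Finset.mul_sum]
  exact Finset.sum_congr rfl fun l _ => mul_assoc _ _ _

end Immersion

end CRGeom

namespace CRGeom

/-! ### Existence of the maxima and the comparison with mean curvature. -/

section Invariants

variable {n q : ℕ} {M : Type*} [TopologicalSpace M] [ChartedSpace (EuclideanSpace ℝ (Fin n)) M]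

/-- Purely combinatorial: positive parts with sum `s` force `k ≤ s` and `νᵢ ≤ s`, so there are
finitely many values. -/
theorem isGreatest_maxNormalizedDelta
    [RiemannianBundle (fun x : M => TangentSpace (𝓡 n) x)]
    (D : ∀ x : M, Submodule ℝ (TangentSpace (𝓡 n) x)) {s : ℕ}
    (hs : 2 ≤ s) (x : M) :
    IsGreatest (normalizedDeltaValues D s x) (maxNormalizedDelta D s x) := by
  have hfin : (normalizedDeltaValues D s x).Finite := by
    refine Set.Finite.subset (Set.finite_range fun p : Σ k : Fin (s + 1), (Fin k → Fin (s + 1)) =>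
      normalizedDelta D (fun i => (p.2 i : ℕ)) x) ?_
    rintro _ ⟨k, ν, -, hν, hsum, rfl⟩
    have hk : k ≤ s := by
      have h := Finset.card_nsmul_le_sum Finset.univ ν 1 fun i _ => hν i
      simpa [hsum] using h
    have hle : ∀ i, ν i ≤ s := fun i =>
      hsum ▸ Finset.single_le_sum (fun _ _ => Nat.zero_le _) (Finset.mem_univ i)
    exact ⟨⟨⟨k, Nat.lt_succ_of_le hk⟩, fun i => ⟨ν i, Nat.lt_succ_of_le (hle i)⟩⟩, rfl⟩
  have hne : (normalizedDeltaValues D s x).Nonempty :=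
    -- The partition of `s` into ones has `k = s`, which is admissible because `2 ≤ s`.
    ⟨_, s, fun _ => 1, hs, fun _ => le_rfl, by simp, rfl⟩
  obtain ⟨r, hr⟩ := hfin.isCompact.exists_isGreatest hne
  rw [maxNormalizedDelta, hr.csSup_eq]
  exact hr

variable [IsManifold (𝓡 n) ∞ M] [RiemannianBundle (fun x : M => TangentSpace (𝓡 n) x)]
  {f : M → EuclideanSpace ℂ (Fin q)}

theorem mutualCurvature_eq (hf : ContMDiff (𝓡 n) 𝓘(ℝ, EuclideanSpace ℂ (Fin q)) ∞ f)
    (hiso : ∀ (x : M) (v w : TangentSpace (𝓡 n) x),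
      inner ℝ (differential n f x v) (differential n f x w) = inner ℝ v w) (x : M)
    {k : ℕ} {ν : Fin k → ℕ} {V : Fin k → Submodule ℝ (TangentSpace (𝓡 n) x)}
    {v : ∀ i, Fin (ν i) → TangentSpace (𝓡 n) x} (hv : ∀ i, Orthonormal ℝ (v i))
    (hV : ∀ i, Submodule.span ℝ (Set.range (v i)) = V i) :
    mutualCurvature x V = ∑ i, ∑ j ∈ Finset.Ioi i, ∑ a, ∑ b,
      gaussTerm (secondFundamentalBilin f x) (v i a) (v j b) := by
  unfold mutualCurvature mutualCurvature₂
  refine Finset.sum_congr rfl fun i _ => Finset.sum_congr rfl fun j _ => ?_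
  rw [← sum_gaussTerm_stdOrthonormalBasis (secondFundamentalBilin f x) (hv i) (hv j) (hV i) (hV j)]
  simp only [riemann_eq hf hiso, gaussTerm]

theorem meanCurvature_eq (hf : ContMDiff (𝓡 n) 𝓘(ℝ, EuclideanSpace ℂ (Fin q)) ∞ f)
    (hiso : ∀ (x : M) (v w : TangentSpace (𝓡 n) x),
      inner ℝ (differential n f x v) (differential n f x w) = inner ℝ v w) (x : M)
    {ι : Type*} [Fintype ι] {V : Submodule ℝ (TangentSpace (𝓡 n) x)}
    {v : ι → TangentSpace (𝓡 n) x} (hv : Orthonormal ℝ v)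
    (hV : Submodule.span ℝ (Set.range v) = V) :
    meanCurvature n f x V = ∑ i, secondFundamentalBilin f x (v i) (v i) := by
  unfold meanCurvature
  rw [← sum_bilin_stdOrthonormalBasis_eq hv hV]
  simp only [secondFundamentalForm_eq hf hiso]

/-- Orthogonal subspaces of prescribed dimensions amount to one orthonormal frame cut into blocks.
This presents the values as the image of a compact set. -/
theorem mutualCurvatureValues_eq_image
    (hf : ContMDiff (𝓡 n) 𝓘(ℝ, EuclideanSpace ℂ (Fin q)) ∞ f)
    (hiso : ∀ (x : M) (v w : TangentSpace (𝓡 n) x),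
      inner ℝ (differential n f x v) (differential n f x w) = inner ℝ v w)
    (D : ∀ x : M, Submodule ℝ (TangentSpace (𝓡 n) x)) {k : ℕ} (ν : Fin k → ℕ) (x : M) :
    mutualCurvatureValues D ν x =
      (fun v : (Σ i, Fin (ν i)) → TangentSpace (𝓡 n) x => ∑ i, ∑ j ∈ Finset.Ioi i, ∑ a, ∑ b,
        gaussTerm (secondFundamentalBilin f x) (v ⟨i, a⟩) (v ⟨j, b⟩)) ''
      {v | Orthonormal ℝ v ∧ ∀ p, v p ∈ D x} := by
  ext r
  constructor
  · rintro ⟨V, hVD, horth, hdim, rfl⟩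
    choose v hv hspan using fun i => exists_orthonormal_span_eq (V i) (hdim i)
    have hmem : ∀ i a, v i a ∈ V i := fun i a => by
      rw [← hspan i]
      exact Submodule.subset_span ⟨a, rfl⟩
    exact ⟨fun p => v p.1 p.2, ⟨orthonormal_sigma hv hmem horth, fun p => hVD _ (hmem _ _)⟩,
      (mutualCurvature_eq hf hiso x hv hspan).symm⟩
  · rintro ⟨v, ⟨hv, hvD⟩, rfl⟩
    have hvi : ∀ i, Orthonormal ℝ fun a => v ⟨i, a⟩ := fun i =>
      hv.comp (fun a => (⟨i, a⟩ : Σ i, Fin (ν i)))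
        fun _ _ h => eq_of_heq (Sigma.mk.inj h).2
    refine ⟨fun i => Submodule.span ℝ (Set.range fun a => v ⟨i, a⟩), fun i => ?_, fun i j hij => ?_,
      fun i => ?_, (mutualCurvature_eq hf hiso x hvi fun _ => rfl).symm⟩
    · rw [Submodule.span_le]
      rintro _ ⟨a, rfl⟩
      exact hvD _
    · rw [Submodule.isOrtho_span]
      rintro _ ⟨a, rfl⟩ _ ⟨b, rfl⟩
      exact hv.2 fun h => hij (congrArg Sigma.fst h)
    · rw [finrank_span_eq_card (hvi i).linearIndependent, Fintype.card_fin]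

theorem isGreatest_deltaPlus (hf : ContMDiff (𝓡 n) 𝓘(ℝ, EuclideanSpace ℂ (Fin q)) ∞ f)
    (hiso : ∀ (x : M) (v w : TangentSpace (𝓡 n) x),
      inner ℝ (differential n f x v) (differential n f x w) = inner ℝ v w)
    (D : ∀ x : M, Submodule ℝ (TangentSpace (𝓡 n) x)) {k : ℕ} (ν : Fin k → ℕ) (x : M)
    (h : ∑ i, ν i ≤ finrank ℝ (D x)) :
    IsGreatest (mutualCurvatureValues D ν x) (deltaPlus D ν x) := by
  have hex : ∃ r, IsGreatest (mutualCurvatureValues D ν x) r := by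
    rw [mutualCurvatureValues_eq_image hf hiso]
    refine IsCompact.exists_isGreatest ((isCompact_orthonormal_frames (D x) _).image ?_)
      ((exists_orthonormal_frame (D x) _ (by simpa using h)).image _)
    exact continuous_finsetSum _ fun i _ => continuous_finsetSum _ fun j _ =>
      continuous_finsetSum _ fun a _ => continuous_finsetSum _ fun b _ =>
        continuous_gaussTerm _ (continuous_apply _) (continuous_apply _)
  obtain ⟨r, hr⟩ := hex
  rw [deltaPlus, hr.csSup_eq]
  exact hr

theorem meanCurvatureValues_eq_image
    (hf : ContMDiff (𝓡 n) 𝓘(ℝ, EuclideanSpace ℂ (Fin q)) ∞ f)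
    (hiso : ∀ (x : M) (v w : TangentSpace (𝓡 n) x),
      inner ℝ (differential n f x v) (differential n f x w) = inner ℝ v w) (s : ℕ) (x : M) :
    meanCurvatureValues n f s x =
      (fun v : Fin s → TangentSpace (𝓡 n) x => ‖∑ i, secondFundamentalBilin f x (v i) (v i)‖) ''
      {v | Orthonormal ℝ v ∧ ∀ i, v i ∈ complexDistribution n f x} := by
  ext r
  constructor
  · rintro ⟨V, hVD, hdim, rfl⟩
    obtain ⟨v, hv, hspan⟩ := exists_orthonormal_span_eq V hdim
    refine ⟨v, ⟨hv, fun i => hVD ?_⟩, congrArg norm (meanCurvature_eq hf hiso x hv hspan).symm⟩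
    rw [← hspan]
    exact Submodule.subset_span ⟨i, rfl⟩
  · rintro ⟨v, ⟨hv, hvD⟩, rfl⟩
    refine ⟨Submodule.span ℝ (Set.range v), ?_, ?_,
      congrArg norm (meanCurvature_eq hf hiso x hv rfl).symm⟩
    · rw [Submodule.span_le]
      rintro _ ⟨a, rfl⟩
      exact hvD _
    · rw [finrank_span_eq_card hv.linearIndependent, Fintype.card_fin]

theorem isGreatest_maxMeanCurvature
    (hf : ContMDiff (𝓡 n) 𝓘(ℝ, EuclideanSpace ℂ (Fin q)) ∞ f)
    (hiso : ∀ (x : M) (v w : TangentSpace (𝓡 n) x),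
      inner ℝ (differential n f x v) (differential n f x w) = inner ℝ v w) (s : ℕ) (x : M)
    (h : s ≤ finrank ℝ (complexDistribution n f x)) :
    IsGreatest (meanCurvatureValues n f s x) (maxMeanCurvature n f s x) := by
  have hex : ∃ r, IsGreatest (meanCurvatureValues n f s x) r := by
    rw [meanCurvatureValues_eq_image hf hiso]
    refine IsCompact.exists_isGreatest ((isCompact_orthonormal_frames _ _).image ?_)
      ((exists_orthonormal_frame _ _ (by simpa using h)).image _)
    exact (continuous_finsetSum _ fun i _ =>
      continuous_bilin _ (continuous_apply _) (continuous_apply _)).norm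
  obtain ⟨r, hr⟩ := hex
  rw [maxMeanCurvature, hr.csSup_eq]
  exact hr

/-- Every normalized mutual curvature is bounded by the squared norm of the mean curvature of the
sum of the subspaces where it is attained. -/
theorem exists_maxNormalizedDelta_le
    (hf : ContMDiff (𝓡 n) 𝓘(ℝ, EuclideanSpace ℂ (Fin q)) ∞ f)
    (hiso : ∀ (x : M) (v w : TangentSpace (𝓡 n) x),
      inner ℝ (differential n f x v) (differential n f x w) = inner ℝ v w)
    (D : ∀ x : M, Submodule ℝ (TangentSpace (𝓡 n) x)) {s : ℕ} (hs : 2 ≤ s) (x : M)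
    (h : s ≤ finrank ℝ (D x)) :
    ∃ V : Submodule ℝ (TangentSpace (𝓡 n) x), V ≤ D x ∧ finrank ℝ V = s ∧
      maxNormalizedDelta D s x ≤ ‖meanCurvature n f x V‖ ^ 2 := by
  -- Take a maximising partition, then a frame maximising the mutual curvature for it; `V` is the
  -- span of the whole frame.
  obtain ⟨k, ν, hk, -, rfl, hr⟩ := (isGreatest_maxNormalizedDelta D hs x).1
  have hδ := (isGreatest_deltaPlus hf hiso D ν x h).1
  rw [mutualCurvatureValues_eq_image hf hiso] at hδ
  obtain ⟨v, ⟨hv, hvD⟩, hδ⟩ := hδ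
  refine ⟨Submodule.span ℝ (Set.range v), ?_, ?_, ?_⟩
  · rw [Submodule.span_le]
    rintro _ ⟨a, rfl⟩
    exact hvD _
  · rw [finrank_span_eq_card hv.linearIndependent]
    simp
  · rw [hr, normalizedDelta, ← hδ, meanCurvature_eq hf hiso x hv rfl]
    exact sum_gaussTerm_le (secondFundamentalBilin f x) (secondFundamentalBilin_comm hf x) hk
      fun i a => v ⟨i, a⟩

end Invariants

end CRGeom

theorem mainTheorem9 {d l q : ℕ} {M : Type*} [TopologicalSpace M]
    [ChartedSpace (EuclideanSpace ℝ (Fin (d + l))) M] [IsManifold (𝓡 (d + l)) ∞ M]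
    [RiemannianBundle (fun x : M => TangentSpace (𝓡 (d + l)) x)]
    (f : M → EuclideanSpace ℂ (Fin q)) (hf : CRGeom.IsCRSubmanifold (d := d) (l := l) f) (x : M) :
    -- all the maxima exist
    (∀ (k : ℕ) (ν : Fin k → ℕ), 2 ≤ k → (∀ i, 1 ≤ ν i) → ∑ i, ν i ≤ d →
      IsGreatest (CRGeom.mutualCurvatureValues (CRGeom.complexDistribution (d + l) f) ν x)
        (CRGeom.deltaPlus (CRGeom.complexDistribution (d + l) f) ν x)) ∧
    (∀ s : ℕ, 2 ≤ s → s ≤ d →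
      IsGreatest (CRGeom.normalizedDeltaValues (CRGeom.complexDistribution (d + l) f) s x)
        (CRGeom.maxNormalizedDelta (CRGeom.complexDistribution (d + l) f) s x)) ∧
    (∀ s : ℕ, 1 ≤ s → s ≤ d →
      IsGreatest (CRGeom.meanCurvatureValues (d + l) f s x) (CRGeom.maxMeanCurvature (d + l) f s x)) ∧
    -- the inequalities
    (∀ s : ℕ, 2 ≤ s → s < d →
      CRGeom.maxNormalizedDelta (CRGeom.complexDistribution (d + l) f) s x
        ≤ CRGeom.maxMeanCurvature (d + l) f s x ^ 2) ∧
    CRGeom.maxNormalizedDelta (CRGeom.complexDistribution (d + l) f) d x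
      ≤ ‖CRGeom.meanCurvature (d + l) f x (CRGeom.complexDistribution (d + l) f x)‖ ^ 2 := by
  obtain ⟨hd, -, hsm, hiso, hfr⟩ := hf
  refine ⟨fun k ν _ _ hν => ?_, fun s hs _ => CRGeom.isGreatest_maxNormalizedDelta _ hs x,
    fun s _ hsd => ?_, fun s hs hsd => ?_, ?_⟩
  · exact CRGeom.isGreatest_deltaPlus hsm hiso _ ν x (hν.trans (hfr x).ge)
  · exact CRGeom.isGreatest_maxMeanCurvature hsm hiso s x (hsd.trans (hfr x).ge)
  · obtain ⟨V, hV, hdim, hle⟩ :=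
      CRGeom.exists_maxNormalizedDelta_le hsm hiso (CRGeom.complexDistribution (d + l) f) hs x
        (hsd.le.trans (hfr x).ge)
    refine hle.trans (pow_le_pow_left₀ (norm_nonneg _) ?_ 2)
    exact (CRGeom.isGreatest_maxMeanCurvature hsm hiso s x (hsd.le.trans (hfr x).ge)).2
      ⟨V, hV, hdim, rfl⟩
  -- For `d < 2` there is no partition into at least two positive parts, and the supremum of the
  -- empty set is `0` by convention.
  · rcases Nat.lt_or_ge d 2 with hd2 | hd2
    · have hempty : CRGeom.normalizedDeltaValues (CRGeom.complexDistribution (d + l) f) d x = ∅ := by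
        refine Set.eq_empty_of_forall_notMem ?_
        rintro _ ⟨k, ν, hk, hν, hsum, -⟩
        have h := Finset.card_nsmul_le_sum Finset.univ ν 1 fun i _ => hν i
        simp only [hsum, Finset.card_univ, Fintype.card_fin, smul_eq_mul, mul_one] at h
        omega
      rw [CRGeom.maxNormalizedDelta, hempty, Real.sSup_empty]
      positivity
    · obtain ⟨V, hV, hdim, hle⟩ :=
        CRGeom.exists_maxNormalizedDelta_le hsm hiso (CRGeom.complexDistribution (d + l) f) hd2 x
          (hfr x).ge
      -- For `s = d` the subspace fills `D`, so `H_V` is `H_D` itself.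
      rwa [Submodule.eq_of_le_of_finrank_eq hV (hdim.trans (hfr x).symm)] at hle
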